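/- Let $(X,d)$ be a Polish metric space and let $d_L : X\times X\to[0,+\infty]$ be a Borel function which is a distance, the value $+\infty$ being allowed. A geodesic is a map $\gamma: I\to X$ on an interval $I\subset\mathbb R$ (open, closed or half-open, bounded or unbounded) with $d_L(\gamma(s),\gamma(t))=|t-s|$ for all $s,t\in I$. Assume that 1. $(X,d_L)$ is a geodesic space: any $x,y\in X$ with $d_L(x,y)<+\infty$ are the end points of a geodesic $\gamma:[0,d_L(x,y)]\to X$; 2. $(X,d_L)$ is non-branching: two geodesics $\gamma_1,\gamma_2:[0,l]\to X$ that agree on $[0,s]$ for some $0<s\le l$ agree on $[0,l]$; 3. geodesics are continuous with respect to $d$; 4. geodesics are locally compact in $(X,d)$: for every geodesic $\gamma: I\to X$ and every $x\in\gamma(I)$ there is $r>0$ such that $\gamma^{-1}(\{z: d(x,z)\le r\})$ is a compact subset of $\mathbb R$. A set $\Gamma\subset X\times X$ is $d_L$-cyclically monotone if $\sum_{i=0}^n d_L(x_i,y_i)\le\sum_{i=0}^n d_L(x_{i+1},y_i)$, with $x_{n+1}=x_0$, for all $n\ge 0$ and all $(x_0,y_0),\dots,(x_n,y_n)\in\Gamma$.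 For Borel probability measures $\mu,\nu$ on $X$, let $\Pi(\mu,\nu)$ be the set of Borel probability measures on $X\times X$ with first marginal $\mu$ and second marginal $\nu$; such a plan is $d_L$-cyclically monotone if it is concentrated on a Borel $d_L$-cyclically monotone set. Let $\mu\wedge\nu$ be the largest Borel measure that is $\le\mu$ and $\le\nu$. Then for all Borel probability measures $\mu,\nu$ on $X$ and every $d_L$-cyclically monotone $\pi\in\Pi(\mu,\nu)$ of finite cost $\int d_L\,d\pi<+\infty$ there is a $d_L$-cyclically monotone $\tilde\pi\in\Pi(\mu,\nu)$ such that $$\int d_L\,d\tilde\pi=\int d_L\,d\pi$$ and $\tilde\pi$ leaves the common mass in place: $$\tilde\pi\ \ge\ (\mathrm{Id},\mathrm{Id})_\sharp(\mu\wedge\nu).$$ -/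

import Mathlib

open MeasureTheory Set
open scoped ENNReal

/-- `c` is an extended distance on `X`: a distance that may take the value `∞`. -/
structure IsExtDistance {X : Type*} (c : X → X → ℝ≥0∞) : Prop where
  eq_zero_iff : ∀ x y, c x y = 0 ↔ x = y
  symm : ∀ x y, c x y = c y x
  triangle : ∀ x y z, c x z ≤ c x y + c y z

/-- `γ`, restricted to the interval `I` (of any kind: open, closed, half-open, bounded or not),
is a geodesic of `(X, c)` parametrized by arc length: the `c`-length of each arc equals the
`c`-distance of its end points. Values of `γ` outside `I` are irrelevant. -/
def IsGeodesicOn {X : Type*} (c : X → X → ℝ≥0∞) (I : Set ℝ) (γ : ℝ → X) : Prop :=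
  I.OrdConnected ∧ ∀ s ∈ I, ∀ t ∈ I, c (γ s) (γ t) = ENNReal.ofReal |t - s|

/-- Any two points at finite distance are joined by a geodesic. -/
def IsGeodesicDistance {X : Type*} (c : X → X → ℝ≥0∞) : Prop :=
  ∀ x y, c x y ≠ ∞ →
    ∃ γ : ℝ → X, IsGeodesicOn c (Icc 0 (c x y).toReal) γ ∧ γ 0 = x ∧ γ (c x y).toReal = y

/-- Geodesics do not bifurcate in their interior: two geodesics that agree on a nontrivial
initial arc agree everywhere. -/
def IsNonBranching {X : Type*} (c : X → X → ℝ≥0∞) : Prop :=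
  ∀ (γ₁ γ₂ : ℝ → X) (s l : ℝ), 0 < s → s ≤ l →
    IsGeodesicOn c (Icc 0 l) γ₁ → IsGeodesicOn c (Icc 0 l) γ₂ →
    EqOn γ₁ γ₂ (Icc 0 s) → EqOn γ₁ γ₂ (Icc 0 l)

/-- All geodesics of `(X, c)` are continuous for the topology of `X`. -/
def GeodesicsContinuous {X : Type*} [TopologicalSpace X] (c : X → X → ℝ≥0∞) : Prop :=
  ∀ (I : Set ℝ) (γ : ℝ → X), IsGeodesicOn c I γ → ContinuousOn γ I

/-- All geodesics of `(X, c)` are locally compact for the metric of `X`: every point of a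
geodesic is the centre of a closed ball of positive radius with compact preimage in `ℝ`. -/
def GeodesicsLocallyCompact {X : Type*} [MetricSpace X] (c : X → X → ℝ≥0∞) : Prop :=
  ∀ (I : Set ℝ) (γ : ℝ → X), IsGeodesicOn c I γ →
    ∀ t ∈ I, ∃ r : ℝ, 0 < r ∧ IsCompact (I ∩ γ ⁻¹' Metric.closedBall (γ t) r)

/-- `c`-cyclically monotone subsets of `X × Y`; the index `i + 1` is taken modulo `n + 1`. -/
def IsCyclicallyMonotoneSet {X Y : Type*} (c : X → Y → ℝ≥0∞) (Γ : Set (X × Y)) : Prop :=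
  ∀ (n : ℕ) (p : Fin (n + 1) → X × Y), (∀ i, p i ∈ Γ) →
    ∑ i, c (p i).1 (p i).2 ≤ ∑ i, c (p (i + 1)).1 (p i).2

/-- `π` is a transference plan from `μ` to `ν`. -/
def IsTransferencePlan {X Y : Type*} [MeasurableSpace X] [MeasurableSpace Y]
    (μ : Measure X) (ν : Measure Y) (π : Measure (X × Y)) : Prop :=
  IsProbabilityMeasure π ∧ π.map Prod.fst = μ ∧ π.map Prod.snd = ν

/-- `π` is `c`-cyclically monotone: it is concentrated on a `c`-cyclically monotone set. -/
def IsCyclicallyMonotonePlan {X Y : Type*} [MeasurableSpace X] [MeasurableSpace Y]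
    (c : X → Y → ℝ≥0∞) (π : Measure (X × Y)) : Prop :=
  ∃ Γ : Set (X × Y), MeasurableSet Γ ∧ IsCyclicallyMonotoneSet c Γ ∧ π Γᶜ = 0

/-- The cost of the plan `π`. -/
noncomputable def transportCost {X Y : Type*} [MeasurableSpace X] [MeasurableSpace Y]
    (c : X → Y → ℝ≥0∞) (π : Measure (X × Y)) : ℝ≥0∞ :=
  ∫⁻ p, c p.1 p.2 ∂π

/-! Disintegrate `π = μ ⊗ₘ K` and write `μ ⊓ ν = f ν` with `0 ≤ f ≤ 1`, `m = μ - μ ⊓ ν`. Run the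
Markov chain of kernel `K` from `m`, stopping it after each step, at the point `y` reached, with
probability `1 - f y`: arriving mass that does not stop takes over the journey of the common mass at
`y`. The law of (start, stopping point) carries `m` to `ν - μ ⊓ ν`; the new plan adds the common
mass on the diagonal.

Start and stopping point are joined by a chain in a cyclically monotone set `Γ`, and such pairs
again form a cyclically monotone set (`IsCyclicallyMonotoneSet.chainClosure`). Hence distance is
additive along chains, and the stopped law costs as much as all the steps made, that is, as `s ⊗ₘ K`
with `s` the occupation measure (`lintegral_sum_stoppedLaw`).

It remains to see that `R = μ - s` costs nothing. Both `s` and `μ` solve `σ = m + f (σ K)` and `s`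
is the least solution, so `R` is a positive stationary measure (`bind_sub_occupation`). By Poincaré
recurrence a stationary chain returns near its start infinitely often and, if its first step is
nontrivial, makes infinitely many steps of length bounded below. By additivity its positions lie on
a geodesic ray, whose local compactness forbids such returns
(`lintegral_compProd_eq_zero_of_stationary`). -/

/-! ### Chains in a cyclically monotone set. -/

section Chains

variable {X : Type*} {c : X → X → ℝ≥0∞} {Γ : Set (X × X)}

/-- The pairs of points joined by a finite chain of pairs in `Γ`. -/
def chainClosure (Γ : Set (X × X)) : Set (X × X) :=
  {p | Relation.ReflTransGen (fun a b => (a, b) ∈ Γ) p.1 p.2}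

theorem diag_mem_chainClosure (x : X) : (x, x) ∈ chainClosure Γ :=
  Relation.ReflTransGen.refl

theorem subset_chainClosure : Γ ⊆ chainClosure Γ :=
  fun _ hp => Relation.ReflTransGen.single hp

theorem chainClosure_trans_mem {x y z : X} (hxy : (x, y) ∈ chainClosure Γ) (hyz : (y, z) ∈ Γ) :
    (x, z) ∈ chainClosure Γ :=
  Relation.ReflTransGen.tail hxy hyz

/-- Walks starting at `a`, made of moves along `Γ` (of total length `α`) and of arbitrary jumps
(of total length `β`). -/
inductive IsWalk (c : X → X → ℝ≥0∞) (Γ : Set (X × X)) (a : X) : X → ℝ≥0∞ → ℝ≥0∞ → Prop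
  | nil : IsWalk c Γ a a 0 0
  | move {b e : X} {α β : ℝ≥0∞} (h : IsWalk c Γ a b α β) (he : (b, e) ∈ Γ) :
      IsWalk c Γ a e (α + c b e) β
  | jump {b : X} {α β : ℝ≥0∞} (h : IsWalk c Γ a b α β) (e : X) :
      IsWalk c Γ a e α (β + c e b)

theorem sum_fin_cyclic (n : ℕ) (F : ℕ → ℕ → ℝ≥0∞) :
    ∑ i : Fin (n + 1), F ((i + 1 : Fin (n + 1)) : ℕ) i
      = ∑ i ∈ Finset.range n, F (i + 1) i + F 0 n := by
  rw [Fin.sum_univ_castSucc]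
  simp [Fin.coeSucc_eq_succ, Fin.sum_univ_eq_sum_range (fun i => F (i + 1) i)]

theorem IsCyclicallyMonotoneSet.sum_range_le (hΓ : IsCyclicallyMonotoneSet c Γ) (n : ℕ)
    (x y : ℕ → X) (h : ∀ i ≤ n, (x i, y i) ∈ Γ) :
    ∑ i ∈ Finset.range (n + 1), c (x i) (y i)
      ≤ ∑ i ∈ Finset.range n, c (x (i + 1)) (y i) + c (x 0) (y n) := by
  have := hΓ n (fun i => (x i, y i)) (fun i => h i (Nat.lt_succ_iff.mp i.2))
  rwa [sum_fin_cyclic n (fun i j => c (x i) (y j)),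
    Fin.sum_univ_eq_sum_range (fun i => c (x i) (y i))] at this

/-- Consecutive jumps merge by the triangle inequality, so that single jumps separate the pairs of
`Γ`, as in a cyclic sum. -/
theorem IsWalk.normal_form (hc : IsExtDistance c) {a b : X} {α β : ℝ≥0∞}
    (h : IsWalk c Γ a b α β) :
    (α = 0 ∧ c b a ≤ β) ∨ ∃ (n : ℕ) (x y : ℕ → X), (∀ i ≤ n, (x i, y i) ∈ Γ) ∧
      α = ∑ i ∈ Finset.range (n + 1), c (x i) (y i) ∧
      c (x 0) a + ∑ i ∈ Finset.range n, c (x (i + 1)) (y i) + c b (y n) ≤ β := by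
  induction h with
  | nil => exact Or.inl ⟨rfl, by simp [(hc.eq_zero_iff a a).2 rfl]⟩
  | @move b e α β h he ih =>
    right
    rcases ih with ⟨rfl, hβ⟩ | ⟨n, x, y, hmem, hα, hβ⟩
    · refine ⟨0, fun _ => b, fun _ => e, fun _ _ => he, by simp, ?_⟩
      simpa [(hc.eq_zero_iff e e).2 rfl] using hβ
    -- The trailing jump to `b` becomes the one between pairs `n` and `n + 1`; the new trailing jump
    -- has length `c e e = 0`.
    · refine ⟨n + 1, Function.update x (n + 1) b, Function.update y (n + 1) e, ?_, ?_, ?_⟩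
      · intro i hi
        rcases eq_or_ne i (n + 1) with rfl | hne
        · simpa using he
        · simpa [Function.update_of_ne hne] using hmem i (by omega)
      · rw [Finset.sum_range_succ, hα]
        simp only [Function.update_self]
        congr 1
        refine Finset.sum_congr rfl fun i hi => ?_
        have : i ≠ n + 1 := by simp at hi; omega
        simp [Function.update_of_ne this]
      · refine le_trans (le_of_eq ?_) hβ
        rw [Finset.sum_range_succ]
        have h1 : ∑ i ∈ Finset.range n, c (Function.update x (n + 1) b (i + 1))
            (Function.update y (n + 1) e i) = ∑ i ∈ Finset.range n, c (x (i + 1)) (y i) := by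
          refine Finset.sum_congr rfl fun i hi => ?_
          have h1 : i ≠ n + 1 := by simp at hi; omega
          have h2 : i ≠ n := by simp at hi; omega
          simp [h1, h2]
        rw [h1]
        simp [(hc.eq_zero_iff e e).2 rfl, add_assoc]
  | @jump b α β h e ih =>
    rcases ih with ⟨rfl, hβ⟩ | ⟨n, x, y, hmem, hα, hβ⟩
    · refine Or.inl ⟨rfl, ?_⟩
      calc c e a ≤ c e b + c b a := hc.triangle _ _ _
        _ ≤ c e b + β := by gcongr
        _ = _ := add_comm _ _
    · refine Or.inr ⟨n, x, y, hmem, hα, ?_⟩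
      calc _ ≤ c (x 0) a + ∑ i ∈ Finset.range n, c (x (i + 1)) (y i) + (c e b + c b (y n)) := by
            gcongr; exact hc.triangle _ _ _
        _ = c (x 0) a + ∑ i ∈ Finset.range n, c (x (i + 1)) (y i) + c b (y n) + c e b := by ring
        _ ≤ _ := by gcongr

/-- Cyclic monotonicity of `Γ` applied to the walk closed up by a jump between its end points. -/
theorem IsWalk.le (hc : IsExtDistance c) (hΓ : IsCyclicallyMonotoneSet c Γ) {a b : X}
    {α β : ℝ≥0∞} (h : IsWalk c Γ a b α β) : α ≤ β + c a b := by
  rcases h.normal_form hc with ⟨rfl, -⟩ | ⟨n, x, y, hmem, rfl, hβ⟩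
  · exact zero_le
  · calc _ ≤ ∑ i ∈ Finset.range n, c (x (i + 1)) (y i) + c (x 0) (y n) :=
          hΓ.sum_range_le n x y hmem
      _ ≤ ∑ i ∈ Finset.range n, c (x (i + 1)) (y i) + (c (x 0) a + (c a b + c b (y n))) := by
          gcongr
          exact (hc.triangle _ _ _).trans (by gcongr; exact hc.triangle _ _ _)
      _ = c (x 0) a + ∑ i ∈ Finset.range n, c (x (i + 1)) (y i) + c b (y n) + c a b := by ring
      _ ≤ _ := by gcongr

theorem IsWalk.move_chain (hc : IsExtDistance c) {a b e : X} {α β : ℝ≥0∞}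
    (h : IsWalk c Γ a b α β) (he : (b, e) ∈ chainClosure Γ) :
    ∃ α', α + c b e ≤ α' ∧ IsWalk c Γ a e α' β := by
  change Relation.ReflTransGen _ b e at he
  induction he with
  | refl => exact ⟨α, by simp [(hc.eq_zero_iff b b).2 rfl], h⟩
  | @tail u v _ huv ih =>
    obtain ⟨α', hα', hw⟩ := ih
    refine ⟨α' + c u v, ?_, hw.move huv⟩
    calc α + c b v ≤ α + (c b u + c u v) := by gcongr; exact hc.triangle _ _ _
      _ = α + c b u + c u v := by ring
      _ ≤ _ := by gcongr

/-- The pairs joined by a chain of a cyclically monotone set form a cyclically monotone set. -/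
theorem IsCyclicallyMonotoneSet.chainClosure (hc : IsExtDistance c)
    (hΓ : IsCyclicallyMonotoneSet c Γ) : IsCyclicallyMonotoneSet c (chainClosure Γ) := by
  intro n p hp
  -- The walk follows a chain from `(p 0).1` to `(p 0).2`, jumps to `(p 1).1`, and so on up to `(p
  -- k).2`. The closing jump is the term `c a b` of `IsWalk.le`.
  have hw : ∀ k (hk : k ≤ n), ∃ α, ∑ i : Fin (k + 1), c (p (Fin.ofNat (n + 1) i)).1
      (p (Fin.ofNat (n + 1) i)).2 ≤ α ∧
      IsWalk c Γ (p 0).1 (p (Fin.ofNat (n + 1) k)).2 α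
        (∑ i ∈ Finset.range k, c (p (Fin.ofNat (n + 1) (i + 1))).1 (p (Fin.ofNat (n + 1) i)).2) := by
    intro k
    induction k with
    | zero =>
      intro _
      obtain ⟨α, h1, h2⟩ := IsWalk.move_chain hc (IsWalk.nil (c := c) (Γ := Γ) (a := (p 0).1)) (hp 0)
      exact ⟨α, by simpa using h1, by simpa using h2⟩
    | succ k ih =>
      intro hk
      obtain ⟨α, h1, h2⟩ := ih (by omega)
      obtain ⟨α', h3, h4⟩ := (h2.jump (p (Fin.ofNat (n + 1) (k + 1))).1).move_chain hc
        (hp (Fin.ofNat (n + 1) (k + 1)))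
      refine ⟨α', le_trans ?_ h3, by rwa [Finset.sum_range_succ]⟩
      rw [Fin.sum_univ_castSucc]
      gcongr
      · exact h1
      · simp
  obtain ⟨α, h1, h2⟩ := hw n le_rfl
  have h3 := h1.trans (h2.le hc hΓ)
  have e := sum_fin_cyclic n
    (fun i j => c (p (Fin.ofNat (n + 1) i)).1 (p (Fin.ofNat (n + 1) j)).2)
  simp only [Fin.ofNat_eq_cast, Fin.cast_val_eq_self] at e h3 ⊢
  rw [e]
  simpa using h3

theorem IsCyclicallyMonotoneSet.mono {Δ : Set (X × X)} (hΓ : IsCyclicallyMonotoneSet c Γ)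
    (h : Δ ⊆ Γ) : IsCyclicallyMonotoneSet c Δ :=
  fun n p hp => hΓ n p fun i => h (hp i)

/-- The distance is additive along chains of a cyclically monotone set. -/
theorem IsCyclicallyMonotoneSet.dist_eq_add (hc : IsExtDistance c)
    (hΓ : IsCyclicallyMonotoneSet c Γ) {x y z : X} (hxy : (x, y) ∈ Γ) (hyz : (y, z) ∈ Γ) :
    c x z = c x y + c y z := by
  refine le_antisymm (hc.triangle _ _ _) ?_
  -- For the pairs `(x, y)`, `(y, z)` the permuted sum is `c y y + c x z`.
  have := hΓ.sum_range_le 1 (fun i => if i = 0 then x else y) (fun i => if i = 0 then y else z)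
    (by intro i hi; interval_cases i <;> simpa)
  simpa [Finset.sum_range_succ, (hc.eq_zero_iff y y).2 rfl] using this

end Chains

/-! ### Geodesic rays and non-recurrence. -/

section Rays

variable {X : Type*} {c : X → X → ℝ≥0∞}

theorem isGeodesicOn_of_le (hc : IsExtDistance c) {I : Set ℝ} {γ : ℝ → X} (hI : I.OrdConnected)
    (h : ∀ s ∈ I, ∀ t ∈ I, s ≤ t → c (γ s) (γ t) = ENNReal.ofReal (t - s)) :
    IsGeodesicOn c I γ := by
  refine ⟨hI, fun s hs t ht => ?_⟩
  rcases le_total s t with hst | hst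
  · rw [h s hs t ht hst, abs_of_nonneg (by linarith)]
  · rw [hc.symm, h t ht s hs hst, abs_sub_comm, abs_of_nonneg (by linarith)]

theorem IsGeodesicOn.eq_ofReal {I : Set ℝ} {γ : ℝ → X} (h : IsGeodesicOn c I γ) {s t : ℝ}
    (hs : s ∈ I) (ht : t ∈ I) (hst : s ≤ t) : c (γ s) (γ t) = ENNReal.ofReal (t - s) := by
  rw [h.2 s hs t ht, abs_of_nonneg (by linarith)]

theorem IsGeodesicOn.concat (hc : IsExtDistance c) {γ g : ℝ → X} {a b : ℝ} (ha : 0 ≤ a)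
    (hb : 0 ≤ b) (hγ : IsGeodesicOn c (Icc 0 a) γ) (hg : IsGeodesicOn c (Icc 0 b) g)
    (hy : γ a = g 0) (hd : c (γ 0) (g b) = ENNReal.ofReal (a + b)) :
    IsGeodesicOn c (Icc 0 (a + b)) (fun t => if t ≤ a then γ t else g (t - a)) := by
  refine isGeodesicOn_of_le hc ordConnected_Icc fun s ⟨hs0, hs⟩ t ⟨ht0, ht⟩ hst => ?_
  by_cases hta : t ≤ a
  · simp only [hta, hst.trans hta, if_true]
    exact hγ.eq_ofReal ⟨hs0, hst.trans hta⟩ ⟨ht0, hta⟩ hst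
  by_cases hsa : s ≤ a
  · simp only [hta, hsa, if_true, if_false]
    push Not at hta
    have h1 : c (γ s) (γ a) = ENNReal.ofReal (a - s) :=
      hγ.eq_ofReal ⟨hs0, hsa⟩ ⟨ha, le_rfl⟩ hsa
    have h2 : c (g 0) (g (t - a)) = ENNReal.ofReal (t - a) := by
      simpa using hg.eq_ofReal (s := 0) (t := t - a) ⟨le_rfl, hb⟩ ⟨by linarith, by linarith⟩
        (by linarith)
    have h3 : c (γ 0) (γ s) = ENNReal.ofReal s := by
      simpa using hγ.eq_ofReal (s := 0) (t := s) ⟨le_rfl, ha⟩ ⟨hs0, hsa⟩ hs0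
    have h4 : c (g (t - a)) (g b) = ENNReal.ofReal (a + b - t) := by
      rw [hg.eq_ofReal (s := t - a) (t := b) ⟨by linarith, by linarith⟩ ⟨hb, le_rfl⟩
        (by linarith)]
      congr 1; ring
    apply le_antisymm
    · calc c (γ s) (g (t - a)) ≤ c (γ s) (γ a) + c (γ a) (g (t - a)) := hc.triangle _ _ _
        _ = ENNReal.ofReal (t - s) := by
          rw [h1, hy, h2, ← ENNReal.ofReal_add (by linarith) (by linarith)]
          congr 1; ring
    -- A shorter middle piece would bring `γ 0` and `g b` closer than `a + b`, against `hd`.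
    · have h5 : ENNReal.ofReal s + ENNReal.ofReal (t - s) + ENNReal.ofReal (a + b - t)
          ≤ ENNReal.ofReal s + c (γ s) (g (t - a)) + ENNReal.ofReal (a + b - t) := by
        rw [← ENNReal.ofReal_add hs0 (by linarith), ← ENNReal.ofReal_add (by linarith)
          (by linarith)]
        have e : s + (t - s) + (a + b - t) = a + b := by ring
        rw [e, ← hd, ← h3, ← h4]
        exact (hc.triangle _ _ _).trans (by gcongr; exact hc.triangle _ _ _)
      rw [ENNReal.add_le_add_iff_right ENNReal.ofReal_ne_top,
        ENNReal.add_le_add_iff_left ENNReal.ofReal_ne_top] at h5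
      exact h5
  · simp only [hta, hsa, if_false]
    push Not at hta hsa
    rw [hg.eq_ofReal (s := s - a) (t := t - a) ⟨by linarith, by linarith⟩
      ⟨by linarith, by linarith⟩ (by linarith)]
    congr 1; ring

/-- A sequence along which the distance is additive and unbounded lies on a geodesic ray. -/
theorem exists_ray (hc : IsExtDistance c) (hgeod : IsGeodesicDistance c) (x : ℕ → X)
    (hfin : ∀ n, c (x n) (x (n + 1)) ≠ ∞)
    (hadd : ∀ n, c (x 0) (x (n + 1)) = c (x 0) (x n) + c (x n) (x (n + 1)))
    (hunb : ∀ M : ℝ, ∃ n, M ≤ (c (x 0) (x n)).toReal) :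
    ∃ γ : ℝ → X, IsGeodesicOn c (Ici 0) γ ∧ ∀ n, γ (c (x 0) (x n)).toReal = x n := by
  choose g hg hg0 hg1 using fun n => hgeod (x n) (x (n + 1)) (hfin n)
  set t : ℕ → ℝ := fun n => (c (x 0) (x n)).toReal with ht
  have hx0 : c (x 0) (x 0) = 0 := (hc.eq_zero_iff _ _).2 rfl
  have ht0 : t 0 = 0 := by simp [ht, hx0]
  have htn : ∀ n, 0 ≤ t n := fun n => ENNReal.toReal_nonneg
  have hfin' : ∀ n, c (x 0) (x n) ≠ ∞ := by
    intro n
    induction n with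
    | zero => simp [hx0]
    | succ n ih => rw [hadd]; exact ENNReal.add_ne_top.2 ⟨ih, hfin n⟩
  have hts : ∀ n, t (n + 1) = t n + (c (x n) (x (n + 1))).toReal := fun n => by
    simp only [ht]; rw [hadd, ENNReal.toReal_add (hfin' n) (hfin n)]
  have htmono : Monotone t := monotone_nat_of_le_succ fun n => by
    rw [hts]; linarith [ENNReal.toReal_nonneg (a := c (x n) (x (n + 1)))]
  let G : ℕ → ℝ → X := fun n => Nat.rec (fun _ => x 0)
    (fun n γ s => if s ≤ t n then γ s else g n (s - t n)) n
  have hGs : ∀ n s, G (n + 1) s = if s ≤ t n then G n s else g n (s - t n) := fun n s => rfl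
  have hG0 : ∀ n, G n 0 = x 0 := by
    intro n
    induction n with
    | zero => rfl
    | succ n ih => rw [hGs, if_pos (htn n), ih]
  have hG : ∀ n, G n (t n) = x n ∧ IsGeodesicOn c (Icc 0 (t n)) (G n) := by
    intro n
    induction n with
    | zero =>
      refine ⟨rfl, isGeodesicOn_of_le hc ordConnected_Icc fun s hs u hu hsu => ?_⟩
      rw [ht0] at hs hu
      have hs' : s = 0 := le_antisymm hs.2 hs.1
      have hu' : u = 0 := le_antisymm hu.2 hu.1
      simp [hs', hu', G, hx0]
    | succ n ih =>
      obtain ⟨ih1, ih2⟩ := ih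
      have h1 : G (n + 1) (t (n + 1)) = x (n + 1) := by
        rw [hGs]
        split_ifs with h
        -- A step of length zero, so `x (n + 1) = x n`.
        · have h2 : t (n + 1) = t n := le_antisymm h (htmono n.le_succ)
          rw [h2, ih1]
          have h3 : (c (x n) (x (n + 1))).toReal = 0 := by linarith [hts n]
          rw [← hc.eq_zero_iff]
          exact ((ENNReal.toReal_eq_zero_iff _).1 h3).resolve_right (hfin n)
        · rw [hts, add_sub_cancel_left, hg1]
      refine ⟨h1, ?_⟩
      rw [hts]
      have h2 : G n (t n) = g n 0 := by rw [ih1, hg0]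
      have h3 : c (G n 0) (g n (c (x n) (x (n + 1))).toReal)
          = ENNReal.ofReal (t n + (c (x n) (x (n + 1))).toReal) := by
        rw [hG0, hg1, ← hts, ENNReal.ofReal_toReal (hfin' _)]
      exact ih2.concat hc (htn n) ENNReal.toReal_nonneg (hg n) h2 h3
  have hcompat : ∀ m n, m ≤ n → ∀ s ≤ t m, G n s = G m s := by
    intro m n hmn s hs
    induction n, hmn using Nat.le_induction with
    | base => rfl
    | succ n hmn ih => rw [hGs, if_pos (hs.trans (htmono hmn)), ih]
  classical
  have hγ : ∀ n s, s ≤ t n → G (Nat.find (hunb s)) s = G n s := by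
    intro n s hs
    rw [hcompat _ n (Nat.find_min' (hunb s) hs) s (Nat.find_spec (hunb s))]
  refine ⟨fun s => G (Nat.find (hunb s)) s, isGeodesicOn_of_le hc ordConnected_Ici ?_, ?_⟩
  · intro s hs u hu hsu
    obtain ⟨n, hn⟩ := hunb u
    simp only [hγ n u hn, hγ n s (hsu.trans hn)]
    exact (hG n).2.eq_ofReal ⟨hs, hsu.trans hn⟩ ⟨hu, hn⟩ hsu
  · intro n
    exact (hγ n (t n) le_rfl).trans (hG n).1

/-- When geodesics are locally compact, a sequence along which the distance is additive and
unbounded is not recurrent. -/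
theorem not_recurrent_of_frequently_lt [MetricSpace X] (hc : IsExtDistance c)
    (hgeod : IsGeodesicDistance c) (hlc : GeodesicsLocallyCompact c) (x : ℕ → X)
    (hfin : ∀ n, c (x n) (x (n + 1)) ≠ ∞)
    (hadd : ∀ n, c (x 0) (x (n + 1)) = c (x 0) (x n) + c (x n) (x (n + 1)))
    {ε : ℝ} (hε : 0 < ε)
    (hlen : ∃ᶠ n in Filter.atTop, ENNReal.ofReal ε < c (x n) (x (n + 1)))
    (hrec : ∀ s ∈ nhds (x 0), ∃ᶠ n in Filter.atTop, x n ∈ s) : False := by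
  have hx0 : c (x 0) (x 0) = 0 := (hc.eq_zero_iff _ _).2 rfl
  have hfin' : ∀ n, c (x 0) (x n) ≠ ∞ := by
    intro n
    induction n with
    | zero => simp [hx0]
    | succ n ih => rw [hadd]; exact ENNReal.add_ne_top.2 ⟨ih, hfin n⟩
  have hts : ∀ n, (c (x 0) (x (n + 1))).toReal
      = (c (x 0) (x n)).toReal + (c (x n) (x (n + 1))).toReal := fun n => by
    rw [hadd, ENNReal.toReal_add (hfin' n) (hfin n)]
  have htmono : Monotone fun n => (c (x 0) (x n)).toReal := monotone_nat_of_le_succ fun n => by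
    rw [hts]; linarith [ENNReal.toReal_nonneg (a := c (x n) (x (n + 1)))]
  have hk : ∀ k : ℕ, ∃ n, k * ε ≤ (c (x 0) (x n)).toReal := by
    intro k
    induction k with
    | zero => exact ⟨0, by simp⟩
    | succ k ih =>
      obtain ⟨n, hn⟩ := ih
      obtain ⟨m, hm, hmε⟩ := Filter.frequently_atTop.1 hlen n
      refine ⟨m + 1, ?_⟩
      have h1 := htmono hm
      have h2 := (ENNReal.ofReal_lt_iff_lt_toReal hε.le (hfin m)).1 hmε
      simp only at h1
      rw [hts]; push_cast; linarith
  have hunb : ∀ M : ℝ, ∃ n, M ≤ (c (x 0) (x n)).toReal := by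
    intro M
    obtain ⟨k, hkM⟩ := exists_nat_ge (M / ε)
    obtain ⟨n, hn⟩ := hk k
    exact ⟨n, ((div_le_iff₀ hε).1 hkM).trans hn⟩
  have htop := Filter.tendsto_atTop_atTop_of_monotone htmono hunb
  obtain ⟨γ, hγ, hγx⟩ := exists_ray hc hgeod x hfin hadd hunb
  have hγ0 : γ 0 = x 0 := by simpa [hx0] using hγx 0
  -- The ray is near its origin only at a compact, hence bounded, set of times, whereas the times of
  -- the `x n` tend to infinity.
  obtain ⟨r, hr, hcpt⟩ := hlc _ γ hγ 0 (by simp)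
  obtain ⟨B, hB⟩ := hcpt.bddAbove
  rw [hγ0] at hB
  obtain ⟨n, hn1, hn2⟩ := ((hrec _ (Metric.closedBall_mem_nhds (x 0) hr)).and_eventually
    (htop.eventually (Filter.eventually_gt_atTop B))).exists
  refine absurd (hB ⟨?_, ?_⟩) (not_le.2 hn2)
  · exact ENNReal.toReal_nonneg
  · simpa only [mem_preimage, hγx] using hn1

end Rays

/-! ### Stationary chains as measure-preserving maps. -/

section Stationary

open ProbabilityTheory unitInterval

variable {X : Type*} [MeasurableSpace X] [StandardBorelSpace X] [Nonempty X]

/-- A stationary Markov kernel is driven by a measure preserving map of `X × [0, 1]`. -/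
theorem exists_measurePreserving_of_stationary (K : Kernel X X) [IsMarkovKernel K] (R : Measure X)
    [IsFiniteMeasure R] (hR : R.bind K = R) :
    ∃ T : X × I → X × I, MeasurePreserving T (R.prod volume) (R.prod volume) ∧
      (R.prod volume).map (fun z => (z.1, (T z).1)) = R ⊗ₘ K := by
  -- One uniform variable produces both the next position and a fresh independent uniform variable,
  -- so iterating the map simulates the chain.
  obtain ⟨f, hf, hfK⟩ :=
    Kernel.exists_measurable_map_eq_unitInterval (K ×ₖ Kernel.const X (volume : Measure I))
  have hf' : ∀ x, Measurable (f x) := fun x => hf.comp measurable_prodMk_left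
  have hT : Measurable fun z : X × I => f z.1 z.2 := hf
  refine ⟨fun z => f z.1 z.2, ⟨hT, ?_⟩, ?_⟩
  · refine Measure.ext_of_lintegral _ fun g hg => ?_
    have hgT : Measurable fun z : X × I => g (f z.1 z.2) := hg.comp hT
    rw [lintegral_map hg hT, lintegral_prod _ hgT.aemeasurable,
      lintegral_prod _ hg.aemeasurable]
    conv_rhs => rw [← hR]
    rw [Measure.lintegral_bind K.aemeasurable hg.lintegral_prod_right'.aemeasurable]
    refine lintegral_congr fun x => ?_
    rw [← lintegral_map hg (hf' x), hfK, Kernel.prod_apply, Kernel.const_apply,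
      lintegral_prod _ hg.aemeasurable]
  · refine Measure.ext_of_lintegral _ fun g hg => ?_
    have hm : Measurable fun z : X × I => (z.1, (f z.1 z.2).1) :=
      measurable_fst.prodMk (measurable_fst.comp hT)
    have hgm : Measurable fun z : X × I => g (z.1, (f z.1 z.2).1) := hg.comp hm
    rw [lintegral_map hg hm, lintegral_prod _ hgm.aemeasurable,
      Measure.lintegral_compProd hg]
    refine lintegral_congr fun x => ?_
    have hg' : Measurable fun y : X × I => g (x, y.1) :=
      hg.comp (measurable_const.prodMk measurable_fst)
    rw [← lintegral_map (f := fun y : X × I => g (x, y.1)) hg' (hf' x), hfK, Kernel.prod_apply,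
      Kernel.const_apply, lintegral_prod _ hg'.aemeasurable]
    simp

end Stationary

/-! ### Stationary plans cost nothing. -/

section Recurrence

open ProbabilityTheory unitInterval

variable {X : Type*} [MetricSpace X] [PolishSpace X] [MeasurableSpace X] [BorelSpace X]
  {c : X → X → ℝ≥0∞}

/-- A plan from a measure to itself which is concentrated on a cyclically monotone set does not
move mass. -/
theorem lintegral_compProd_eq_zero_of_stationary [Nonempty X] (hc : IsExtDistance c)
    (hcm : Measurable fun p : X × X => c p.1 p.2) (hgeod : IsGeodesicDistance c)
    (hlc : GeodesicsLocallyCompact c) {Γ : Set (X × X)}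
    (hΓ : IsCyclicallyMonotoneSet c Γ) (hΓfin : ∀ p ∈ Γ, c p.1 p.2 ≠ ∞)
    (K : Kernel X X) [IsMarkovKernel K] (R : Measure X) [IsFiniteMeasure R] (hR : R.bind K = R)
    (hRΓ : ∀ᵐ p ∂(R ⊗ₘ K), p ∈ Γ) : ∫⁻ p, c p.1 p.2 ∂(R ⊗ₘ K) = 0 := by
  obtain ⟨T, hT, hlaw⟩ := exists_measurePreserving_of_stationary K R hR
  have hpm : Measurable fun z : X × I => (z.1, (T z).1) :=
    measurable_fst.prodMk (measurable_fst.comp hT.measurable)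
  rw [← hlaw] at hRΓ ⊢
  have hstep : ∀ᵐ z ∂(R.prod (volume : Measure I)), (z.1, (T z).1) ∈ Γ :=
    ae_of_ae_map hpm.aemeasurable hRΓ
  have hsteps : ∀ᵐ z ∂(R.prod (volume : Measure I)), ∀ n,
      ((T^[n] z).1, (T^[n + 1] z).1) ∈ Γ := by
    refine ae_all_iff.2 fun n => ?_
    filter_upwards [(hT.iterate n).quasiMeasurePreserving.ae hstep] with z hz
    rwa [Function.iterate_succ_apply']
  -- Poincaré recurrence for a finite invariant measure; it serves both for the long steps and for
  -- the returns near the start.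
  have hcons : Conservative T (R.prod (volume : Measure I)) := hT.conservative
  have hlen : ∀ᵐ z ∂(R.prod (volume : Measure I)), ∀ k : ℕ,
      ENNReal.ofReal (1 / ((k : ℝ) + 1)) < c z.1 (T z).1 → ∃ᶠ n in Filter.atTop,
        ENNReal.ofReal (1 / ((k : ℝ) + 1)) < c (T^[n] z).1 (T (T^[n] z)).1 := by
    refine ae_all_iff.2 fun k => ?_
    exact hcons.ae_mem_imp_frequently_image_mem
      (s := {z | ENNReal.ofReal (1 / ((k : ℝ) + 1)) < c z.1 (T z).1})
      (measurableSet_lt measurable_const (hcm.comp hpm)).nullMeasurableSet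
  have hcpm : Measurable fun z : X × I => c z.1 (T z).1 := hcm.comp hpm
  rw [lintegral_map hcm hpm]
  refine (lintegral_eq_zero_iff hcpm).2 ?_
  filter_upwards [hsteps, hlen, hcons.ae_frequently_mem_of_mem_nhds] with z h1 h2 h3
  by_contra hne
  have hz : c z.1 (T z).1 ≠ 0 := hne
  have hfin : c z.1 (T z).1 ≠ ∞ := hΓfin _ (h1 0)
  obtain ⟨k, hk⟩ := exists_nat_one_div_lt (ENNReal.toReal_pos hz hfin)
  have hk' := h2 k ((ENNReal.ofReal_lt_iff_lt_toReal (by positivity) hfin).2 hk)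
  have hchain : ∀ n, (z.1, (T^[n] z).1) ∈ chainClosure Γ := by
    intro n
    induction n with
    | zero => exact diag_mem_chainClosure _
    | succ n ih => exact chainClosure_trans_mem ih (h1 n)
  refine not_recurrent_of_frequently_lt hc hgeod hlc (fun n => (T^[n] z).1)
    (fun n => hΓfin _ (h1 n))
    (fun n => (hΓ.chainClosure hc).dist_eq_add hc (hchain n) (subset_chainClosure (h1 n)))
    (ε := 1 / ((k : ℝ) + 1)) (by positivity) ?_ ?_
  · refine hk'.mono fun n hn => ?_
    rwa [Function.iterate_succ_apply']
  · intro s hs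
    exact (h3 (Prod.fst ⁻¹' s) (continuous_fst.continuousAt.preimage_mem_nhds hs)).mono
      fun n hn => hn

end Recurrence

/-! ### Almost sure properties of image measures. -/

section PerfectMeasure

/-- Finite measures on Polish spaces are perfect: a property that holds almost surely after
composition with a continuous map holds almost surely for the image measure, without any
measurability assumption. -/
theorem ae_map_of_ae_of_continuous {Z W : Type*} [TopologicalSpace Z] [PolishSpace Z]
    [MeasurableSpace Z] [BorelSpace Z] [TopologicalSpace W] [T2Space W] [MeasurableSpace W]
    [BorelSpace W] (P : Measure Z) [IsFiniteMeasure P] {g : Z → W} (hg : Continuous g)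
    {p : W → Prop} (h : ∀ᵐ z ∂P, p (g z)) : ∀ᵐ w ∂(P.map g), p w := by
  -- The complement of this null hull is exhausted, up to a null set, by compact sets; their images
  -- are closed, hence measurable, and `p` holds on them.
  set N := toMeasurable P {z | ¬ p (g z)} with hN
  have hN0 : P N = 0 := by rw [hN, measure_toMeasurable]; exact h
  have hNm : MeasurableSet N := measurableSet_toMeasurable _ _
  have hex : ∀ n : ℕ, ∃ C ⊆ Nᶜ, IsCompact C ∧ P (Nᶜ \ C) < ((n : ℝ≥0∞) + 1)⁻¹ := fun n =>
    hNm.compl.exists_isCompact_sdiff_lt (measure_ne_top _ _)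
      (ENNReal.inv_ne_zero.2 (by simp))
  choose C hCN hC hCP using hex
  have hm : MeasurableSet (⋃ n, g '' C n) :=
    MeasurableSet.iUnion fun n => ((hC n).image hg).isClosed.measurableSet
  have h0 : P.map g (⋃ n, g '' C n)ᶜ = 0 := by
    rw [Measure.map_apply hg.measurable hm.compl]
    refine le_antisymm (le_of_forall_gt fun ε hε => ?_) zero_le
    obtain ⟨n, hn⟩ := ENNReal.exists_inv_nat_lt hε.ne'
    calc P (g ⁻¹' (⋃ n, g '' C n)ᶜ) ≤ P (N ∪ (Nᶜ \ C n)) := by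
          refine measure_mono fun z hz => ?_
          by_cases hzN : z ∈ N
          · exact Or.inl hzN
          · exact Or.inr ⟨hzN, fun hzC => hz (mem_iUnion.2 ⟨n, mem_image_of_mem g hzC⟩)⟩
      _ ≤ P N + P (Nᶜ \ C n) := measure_union_le _ _
      _ ≤ ((n : ℝ≥0∞) + 1)⁻¹ := by rw [hN0, zero_add]; exact (hCP n).le
      _ ≤ (n : ℝ≥0∞)⁻¹ := ENNReal.inv_le_inv.2 le_self_add
      _ < ε := hn
  filter_upwards [measure_eq_zero_iff_ae_notMem.1 h0] with w hw
  obtain ⟨n, z, hz, rfl⟩ := mem_iUnion.1 (not_not.1 hw)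
  by_contra hp
  exact hCN n hz (subset_toMeasurable P _ hp)

end PerfectMeasure

/-! ### The killed Markov chain and its marginals. -/

section Stopping

open ProbabilityTheory

variable {X : Type*} [MeasurableSpace X]

/-- Move the second coordinate of a random pair by the kernel `K`. -/
noncomputable def pairStep (K : Kernel X X) (Q : Measure (X × X)) : Measure (X × X) :=
  (Q ⊗ₘ (K.comap Prod.snd measurable_snd)).map (fun q => (q.1.1, q.2))

/-- Law of the starting point and of the position after `n` steps of the chain of kernel `K`,
killed after each step with probability `1 - f`. -/
noncomputable def aliveLaw (K : Kernel X X) (f : X → ℝ≥0∞) (m : Measure X) : ℕ → Measure (X × X)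
  | 0 => m.map fun x => (x, x)
  | n + 1 => (pairStep K (aliveLaw K f m n)).withDensity fun p => f p.2

/-- Law of the starting point and of the final position of the chains killed at step `n + 1`. -/
noncomputable def stoppedLaw (K : Kernel X X) (f : X → ℝ≥0∞) (m : Measure X) (n : ℕ) :
    Measure (X × X) :=
  (pairStep K (aliveLaw K f m n)).withDensity fun p => 1 - f p.2

variable {K : Kernel X X} {f : X → ℝ≥0∞} {m : Measure X}

theorem measurable_pairStep_map :
    Measurable fun q : (X × X) × X => (q.1.1, q.2) := by fun_prop

theorem withDensity_le_self {Y : Type*} [MeasurableSpace Y] (Q : Measure Y) {g : Y → ℝ≥0∞}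
    (hg : ∀ y, g y ≤ 1) : Q.withDensity g ≤ Q := by
  conv_rhs => rw [← withDensity_one (μ := Q)]
  exact withDensity_mono (ae_of_all _ hg)

theorem stoppedLaw_add_aliveLaw (hf : Measurable f) (hf1 : ∀ x, f x ≤ 1) (n : ℕ) :
    stoppedLaw K f m n + aliveLaw K f m (n + 1) = pairStep K (aliveLaw K f m n) := by
  have hm : Measurable fun p : X × X => 1 - f p.2 := by fun_prop
  rw [stoppedLaw, aliveLaw, ← withDensity_add_left hm]
  conv_rhs => rw [← withDensity_one (μ := pairStep K (aliveLaw K f m n))]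
  congr 1
  ext p
  simp [tsub_add_cancel_of_le (hf1 p.2)]

theorem map_snd_withDensity (Q : Measure (X × X)) (hf : Measurable f) :
    (Q.withDensity fun p => f p.2).map Prod.snd = (Q.map Prod.snd).withDensity f := by
  refine Measure.ext_of_lintegral _ fun g hg => ?_
  rw [lintegral_map hg measurable_snd,
    lintegral_withDensity_eq_lintegral_mul _ (by fun_prop) (by fun_prop),
    lintegral_withDensity_eq_lintegral_mul _ hf hg, lintegral_map (by fun_prop) measurable_snd]
  rfl

theorem lintegral_bind_withDensity (m : Measure X) (hf : Measurable f) {g : X → ℝ≥0∞}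
    (hg : Measurable g) : ∫⁻ x, g x ∂((m.bind K).withDensity f)
      = ∫⁻ x, ∫⁻ y, f y * g y ∂(K x) ∂m := by
  rw [lintegral_withDensity_eq_lintegral_mul _ hf hg,
    Measure.lintegral_bind K.aemeasurable (by fun_prop)]
  rfl

theorem bind_withDensity_add (m₁ m₂ : Measure X) (hf : Measurable f) :
    ((m₁ + m₂).bind K).withDensity f = (m₁.bind K).withDensity f + (m₂.bind K).withDensity f := by
  refine Measure.ext_of_lintegral _ fun g hg => ?_
  simp only [lintegral_add_measure, lintegral_bind_withDensity _ hf hg]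

theorem bind_withDensity_sum (m : ℕ → Measure X) (hf : Measurable f) :
    ((Measure.sum m).bind K).withDensity f
      = Measure.sum fun n => ((m n).bind K).withDensity f := by
  refine Measure.ext_of_lintegral _ fun g hg => ?_
  simp only [lintegral_sum_measure, lintegral_bind_withDensity _ hf hg]

theorem bind_withDensity_mono {m₁ m₂ : Measure X} (h : m₁ ≤ m₂) (hf : Measurable f) :
    (m₁.bind K).withDensity f ≤ (m₂.bind K).withDensity f := by
  refine Measure.le_iff.2 fun s hs => ?_
  rw [← lintegral_indicator_one hs, ← lintegral_indicator_one hs,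
    lintegral_bind_withDensity _ hf (measurable_one.indicator hs),
    lintegral_bind_withDensity _ hf (measurable_one.indicator hs)]
  exact lintegral_mono' h le_rfl

theorem map_snd_aliveLaw_zero : (aliveLaw K f m 0).map Prod.snd = m := by
  rw [aliveLaw, Measure.map_map measurable_snd (by fun_prop)]
  exact Measure.map_id

theorem map_fst_aliveLaw_zero : (aliveLaw K f m 0).map Prod.fst = m := by
  rw [aliveLaw, Measure.map_map measurable_fst (by fun_prop)]
  exact Measure.map_id

variable (K f m) in
/-- Occupation measure of the killed chain started from `m`. -/
noncomputable def occupation : Measure X :=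
  Measure.sum fun n => (aliveLaw K f m n).map Prod.snd

theorem map_snd_aliveLaw_le (n : ℕ) : (aliveLaw K f m n).map Prod.snd ≤ occupation K f m :=
  Measure.le_sum _ n

theorem sum_range_add_eq {a b : ℕ → ℝ≥0∞} (h : ∀ n, b n + a (n + 1) = a n) (N : ℕ) :
    ∑ n ∈ Finset.range N, b n + a N = a 0 := by
  induction N with
  | zero => simp
  | succ N ih => rw [Finset.sum_range_succ, add_assoc, h, ih]

theorem ae_map_snd_aliveLaw_compProd {μ : Measure X} [IsFiniteMeasure μ]
    {Γ : Set (X × X)}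
    (hocc : occupation K f m ≤ μ) (hμΓ : ∀ᵐ p ∂(μ ⊗ₘ K), p ∈ Γ) (n : ℕ) :
    ∀ᵐ p ∂(((aliveLaw K f m n).map Prod.snd) ⊗ₘ K), p ∈ Γ :=
  (((map_snd_aliveLaw_le n).trans hocc).absolutelyContinuous.compProd_left K).ae_le hμΓ

variable [IsMarkovKernel K]

theorem lintegral_pairStep (Q : Measure (X × X)) [IsFiniteMeasure Q] {g : X × X → ℝ≥0∞}
    (hg : Measurable g) :
    ∫⁻ p, g p ∂(pairStep K Q) = ∫⁻ p, ∫⁻ y, g (p.1, y) ∂(K p.2) ∂Q := by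
  have hg' : Measurable fun q : (X × X) × X => g (q.1.1, q.2) := hg.comp measurable_pairStep_map
  rw [pairStep, lintegral_map hg measurable_pairStep_map, Measure.lintegral_compProd hg']
  simp

instance isFiniteMeasure_pairStep (Q : Measure (X × X)) [IsFiniteMeasure Q] :
    IsFiniteMeasure (pairStep K Q) := by
  unfold pairStep; infer_instance

theorem isFiniteMeasure_aliveLaw [IsFiniteMeasure m] (hf1 : ∀ x, f x ≤ 1) (n : ℕ) :
    IsFiniteMeasure (aliveLaw K f m n) := by
  induction n with
  | zero => unfold aliveLaw; infer_instance
  | succ n ih =>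
    exact isFiniteMeasure_of_le _ (withDensity_le_self (pairStep K (aliveLaw K f m n))
      (fun p => hf1 p.2))

theorem map_fst_pairStep (Q : Measure (X × X)) [IsFiniteMeasure Q] :
    (pairStep K Q).map Prod.fst = Q.map Prod.fst := by
  refine Measure.ext_of_lintegral _ fun g hg => ?_
  rw [lintegral_map hg measurable_fst, lintegral_map hg measurable_fst,
    lintegral_pairStep Q (g := fun p => g p.1) (by fun_prop)]
  simp

theorem map_snd_pairStep (Q : Measure (X × X)) [IsFiniteMeasure Q] :
    (pairStep K Q).map Prod.snd = (Q.map Prod.snd).bind K := by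
  refine Measure.ext_of_lintegral _ fun g hg => ?_
  rw [lintegral_map hg measurable_snd, lintegral_pairStep Q (g := fun p => g p.2) (by fun_prop),
    Measure.lintegral_bind K.aemeasurable hg.aemeasurable,
    lintegral_map hg.lintegral_kernel measurable_snd]

theorem map_snd_aliveLaw_succ [IsFiniteMeasure m] (hf : Measurable f) (hf1 : ∀ x, f x ≤ 1)
    (n : ℕ) : (aliveLaw K f m (n + 1)).map Prod.snd
      = (((aliveLaw K f m n).map Prod.snd).bind K).withDensity f := by
  have := isFiniteMeasure_aliveLaw (K := K) (m := m) hf1 n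
  rw [aliveLaw, map_snd_withDensity _ hf, map_snd_pairStep]

theorem map_snd_stoppedLaw [IsFiniteMeasure m] (hf : Measurable f) (hf1 : ∀ x, f x ≤ 1)
    (n : ℕ) : (stoppedLaw K f m n).map Prod.snd
      = (((aliveLaw K f m n).map Prod.snd).bind K).withDensity (fun x => 1 - f x) := by
  have := isFiniteMeasure_aliveLaw (K := K) (m := m) hf1 n
  rw [stoppedLaw, map_snd_withDensity (f := fun x => 1 - f x) _ (by fun_prop), map_snd_pairStep]

theorem occupation_eq [IsFiniteMeasure m] (hf : Measurable f) (hf1 : ∀ x, f x ≤ 1) :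
    occupation K f m = m + ((occupation K f m).bind K).withDensity f := by
  refine Measure.ext fun s hs => ?_
  rw [occupation, bind_withDensity_sum _ hf, Measure.add_apply, Measure.sum_apply _ hs,
    Measure.sum_apply _ hs, tsum_eq_zero_add' ENNReal.summable, map_snd_aliveLaw_zero]
  simp only [map_snd_aliveLaw_succ hf hf1]

/-- The partial sums iterate the monotone map `σ ↦ m + f (σ K)` from zero, so they stay below any
`μ` that the map does not increase. -/
theorem sum_aliveLaw_le [IsFiniteMeasure m] (hf : Measurable f) (hf1 : ∀ x, f x ≤ 1)
    {μ : Measure X} (hμ : m + (μ.bind K).withDensity f ≤ μ) (N : ℕ) :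
    ∑ n ∈ Finset.range N, (aliveLaw K f m n).map Prod.snd ≤ μ := by
  have hs : ∀ N, ∑ n ∈ Finset.range (N + 1), (aliveLaw K f m n).map Prod.snd
      = m + ((∑ n ∈ Finset.range N, (aliveLaw K f m n).map Prod.snd).bind K).withDensity f := by
    intro N
    induction N with
    | zero => simp [map_snd_aliveLaw_zero]
    | succ N ih =>
      conv_lhs => rw [Finset.sum_range_succ, ih, map_snd_aliveLaw_succ hf hf1, add_assoc,
        ← bind_withDensity_add _ _ hf, ← Finset.sum_range_succ]
  induction N with
  | zero => simpa using Measure.zero_le μ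
  | succ N ih =>
    rw [hs]
    exact le_trans (by gcongr; exact bind_withDensity_mono ih hf) hμ

theorem occupation_le [IsFiniteMeasure m] (hf : Measurable f) (hf1 : ∀ x, f x ≤ 1)
    {μ : Measure X} (hμ : m + (μ.bind K).withDensity f ≤ μ) : occupation K f m ≤ μ := by
  refine Measure.le_iff.2 fun s hs => ?_
  rw [occupation, Measure.sum_apply _ hs, ENNReal.tsum_eq_iSup_nat]
  refine iSup_le fun N => ?_
  have := sum_aliveLaw_le hf hf1 hμ N s
  rwa [Measure.coe_finsetSum, Finset.sum_apply] at this

/-- The part of `μ` which is not reached by the killed chain is stationary. -/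
theorem bind_sub_occupation [IsFiniteMeasure m] (hf : Measurable f) (hf1 : ∀ x, f x ≤ 1)
    {μ : Measure X} [IsFiniteMeasure μ] (hμ : m + (μ.bind K).withDensity f = μ) :
    (μ - occupation K f m).bind K = μ - occupation K f m := by
  set s := occupation K f m with hs
  have hle : s ≤ μ := occupation_le hf hf1 hμ.le
  have : IsFiniteMeasure s := isFiniteMeasure_of_le μ hle
  set R := μ - s with hR
  have hRs : R + s = μ := Measure.sub_add_cancel_of_le hle
  have : IsFiniteMeasure R := isFiniteMeasure_of_le μ Measure.sub_le
  -- `μ` and `s` both solve `σ = m + f (σ K)`; this is the difference of the two equations.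
  have h1 : (R.bind K).withDensity f + s = μ := by
    conv_rhs => rw [← hμ, ← hRs, bind_withDensity_add _ _ hf]
    conv_lhs => rw [hs, occupation_eq hf hf1, ← hs]
    abel
  have h2 : R = (R.bind K).withDensity f := by
    calc R = R + s - s := Measure.add_sub_cancel.symm
      _ = (R.bind K).withDensity f + s - s := by rw [hRs, h1]
      _ = _ := Measure.add_sub_cancel
  have h3 : R ≤ R.bind K := by
    conv_lhs => rw [h2]
    exact withDensity_le_self _ hf1
  symm
  -- A Markov kernel preserves total mass, so the inequality is an equality.
  refine Measure.eq_of_le_of_measure_univ_eq h3 ?_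
  rw [Measure.bind_apply MeasurableSet.univ K.aemeasurable]
  simp

/-- The alive masses sum to the mass of the occupation measure, which is at most that of `μ`. -/
theorem tendsto_aliveLaw_univ [IsFiniteMeasure m] (hf : Measurable f) (hf1 : ∀ x, f x ≤ 1)
    {μ : Measure X} [IsFiniteMeasure μ] (hμ : m + (μ.bind K).withDensity f ≤ μ) :
    Filter.Tendsto (fun n => aliveLaw K f m n univ) Filter.atTop (nhds 0) := by
  refine ENNReal.tendsto_atTop_zero_of_tsum_ne_top ?_
  have h := occupation_le hf hf1 hμ univ
  rw [occupation, Measure.sum_apply _ MeasurableSet.univ] at h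
  have e : ∀ n, (aliveLaw K f m n).map Prod.snd univ = aliveLaw K f m n univ := fun n => by
    rw [Measure.map_apply measurable_snd MeasurableSet.univ, preimage_univ]
  simp only [e] at h
  exact ne_top_of_le_ne_top (measure_ne_top μ univ) h

/-- Each step splits the mass issued from a set of starting points into stopped and alive parts; the
sums telescope and the alive part vanishes. -/
theorem map_fst_sum_stoppedLaw [IsFiniteMeasure m] (hf : Measurable f) (hf1 : ∀ x, f x ≤ 1)
    {μ : Measure X} [IsFiniteMeasure μ] (hμ : m + (μ.bind K).withDensity f ≤ μ) :
    (Measure.sum (stoppedLaw K f m)).map Prod.fst = m := by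
  refine Measure.ext fun s hs => ?_
  rw [Measure.map_apply measurable_fst hs, Measure.sum_apply _ (measurable_fst hs)]
  have h1 : ∀ n, stoppedLaw K f m n (Prod.fst ⁻¹' s) + aliveLaw K f m (n + 1) (Prod.fst ⁻¹' s)
      = aliveLaw K f m n (Prod.fst ⁻¹' s) := by
    intro n
    have := isFiniteMeasure_aliveLaw (K := K) (m := m) hf1 n
    rw [← Measure.add_apply, stoppedLaw_add_aliveLaw hf hf1,
      ← Measure.map_apply measurable_fst hs, map_fst_pairStep, Measure.map_apply measurable_fst hs]
  have h2 : Filter.Tendsto (fun n => aliveLaw K f m n (Prod.fst ⁻¹' s)) Filter.atTop (nhds 0) :=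
    tendsto_of_tendsto_of_tendsto_of_le_of_le tendsto_const_nhds
      (tendsto_aliveLaw_univ hf hf1 hμ) (fun _ => zero_le) (fun _ => measure_mono (subset_univ _))
  have h3 := (ENNReal.tendsto_nat_tsum fun n => stoppedLaw K f m n (Prod.fst ⁻¹' s)).add h2
  simp only [sum_range_add_eq (a := fun n => aliveLaw K f m n (Prod.fst ⁻¹' s)) h1,
    add_zero] at h3
  rw [← tendsto_nhds_unique tendsto_const_nhds h3, ← Measure.map_apply measurable_fst hs,
    map_fst_aliveLaw_zero]

/-- The bound of the occupation measure by `μ` gives one inequality, and both sides have the mass of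
`m`. -/
theorem map_snd_sum_stoppedLaw [IsFiniteMeasure m] (hf : Measurable f) (hf1 : ∀ x, f x ≤ 1)
    {μ : Measure X} [IsFiniteMeasure μ] (hμ : m + (μ.bind K).withDensity f = μ) :
    (Measure.sum (stoppedLaw K f m)).map Prod.snd
      = (μ.bind K).withDensity (fun x => 1 - f x) := by
  have hf' : Measurable fun x => 1 - f x := by fun_prop
  have hb : (μ.bind K) univ = μ univ := by
    rw [Measure.bind_apply MeasurableSet.univ K.aemeasurable]; simp
  have : IsFiniteMeasure (μ.bind K) := ⟨by rw [hb]; exact measure_lt_top _ _⟩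
  have hfin : IsFiniteMeasure ((μ.bind K).withDensity f) :=
    isFiniteMeasure_of_le _ (withDensity_le_self (μ.bind K) hf1)
  have hfin' : IsFiniteMeasure ((μ.bind K).withDensity fun x => 1 - f x) :=
    isFiniteMeasure_of_le _ (withDensity_le_self (μ.bind K) fun x => tsub_le_self)
  have hle : (Measure.sum (stoppedLaw K f m)).map Prod.snd
      ≤ (μ.bind K).withDensity (fun x => 1 - f x) := by
    rw [Measure.map_sum measurable_snd.aemeasurable]
    simp only [map_snd_stoppedLaw hf hf1]
    rw [← bind_withDensity_sum _ hf']
    exact bind_withDensity_mono (occupation_le hf hf1 hμ.le) hf'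
  have : IsFiniteMeasure ((Measure.sum (stoppedLaw K f m)).map Prod.snd) :=
    isFiniteMeasure_of_le _ hle
  refine Measure.eq_of_le_of_measure_univ_eq hle ?_
  have e1 : (Measure.sum (stoppedLaw K f m)).map Prod.snd univ = m univ := by
    conv_rhs => rw [← map_fst_sum_stoppedLaw hf hf1 hμ.le]
    rw [Measure.map_apply measurable_snd MeasurableSet.univ,
      Measure.map_apply measurable_fst MeasurableSet.univ, preimage_univ, preimage_univ]
  have e2 : (μ.bind K).withDensity (fun x => 1 - f x) + (μ.bind K).withDensity f = μ.bind K := by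
    rw [← withDensity_add_left hf']
    conv_rhs => rw [← withDensity_one (μ := μ.bind K)]
    congr 1
    ext x
    simp [tsub_add_cancel_of_le (hf1 x)]
  have e3 : (μ.bind K).withDensity (fun x => 1 - f x) univ + (μ.bind K).withDensity f univ
      = m univ + (μ.bind K).withDensity f univ := by
    rw [← Measure.add_apply, e2, hb, ← Measure.add_apply, hμ]
  rw [e1, (ENNReal.add_left_inj (measure_ne_top _ _)).1 e3]

/-- After one step, the starting point, the current point and the next point form a chain. -/
theorem ae_compProd_comap_snd {Γ : Set (X × X)} {Q : Measure (X × X)} [IsFiniteMeasure Q]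
    (hΓm : MeasurableSet Γ) (hQ : ∀ᵐ p ∂Q, p ∈ chainClosure Γ)
    (hQΓ : ∀ᵐ p ∂((Q.map Prod.snd) ⊗ₘ K), p ∈ Γ) :
    ∀ᵐ q ∂(Q ⊗ₘ (K.comap Prod.snd measurable_snd)), q.1 ∈ chainClosure Γ ∧ (q.1.2, q.2) ∈ Γ := by
  refine Filter.Eventually.and ?_ ?_
  · rw [← Measure.fst_compProd Q (K.comap Prod.snd measurable_snd)] at hQ
    exact ae_of_ae_map measurable_fst.aemeasurable hQ
  · have hm : MeasurableSet {q : (X × X) × X | (q.1.2, q.2) ∈ Γ} :=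
      (measurable_fst.snd.prodMk measurable_snd) hΓm
    rw [Measure.ae_compProd_iff hm]
    exact ae_of_ae_map measurable_snd.aemeasurable (Measure.ae_ae_of_ae_compProd hQΓ)

theorem lintegral_pairStep_eq_add {c : X → X → ℝ≥0∞} {Γ : Set (X × X)}
    (hc : IsExtDistance c) (hcm : Measurable fun p : X × X => c p.1 p.2) (hΓm : MeasurableSet Γ)
    (hΓ : IsCyclicallyMonotoneSet c Γ) {Q : Measure (X × X)} [IsFiniteMeasure Q]
    (hQ : ∀ᵐ p ∂Q, p ∈ chainClosure Γ) (hQΓ : ∀ᵐ p ∂((Q.map Prod.snd) ⊗ₘ K), p ∈ Γ) :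
    ∫⁻ p, c p.1 p.2 ∂(pairStep K Q)
      = ∫⁻ p, c p.1 p.2 ∂Q + ∫⁻ p, c p.1 p.2 ∂((Q.map Prod.snd) ⊗ₘ K) := by
  have h1 : ∫⁻ p, c p.1 p.2 ∂Q
      = ∫⁻ q, c q.1.1 q.1.2 ∂(Q ⊗ₘ (K.comap Prod.snd measurable_snd)) := by
    conv_lhs => rw [← Measure.fst_compProd Q (K.comap Prod.snd measurable_snd)]
    exact lintegral_map hcm measurable_fst
  have hm2 : Measurable fun q : (X × X) × X => c q.1.2 q.2 :=
    hcm.comp (measurable_fst.snd.prodMk measurable_snd)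
  have h2 : ∫⁻ p, c p.1 p.2 ∂((Q.map Prod.snd) ⊗ₘ K)
      = ∫⁻ q, c q.1.2 q.2 ∂(Q ⊗ₘ (K.comap Prod.snd measurable_snd)) := by
    rw [Measure.lintegral_compProd hcm, Measure.lintegral_compProd hm2,
      lintegral_map hcm.lintegral_kernel_prod_right measurable_snd]
    rfl
  have hm1 : Measurable fun q : (X × X) × X => c q.1.1 q.1.2 := hcm.comp measurable_fst
  rw [h1, h2, ← lintegral_add_left hm1, pairStep, lintegral_map hcm measurable_pairStep_map]
  refine lintegral_congr_ae ?_
  filter_upwards [ae_compProd_comap_snd hΓm hQ hQΓ] with q hq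
  exact (hΓ.chainClosure hc).dist_eq_add hc hq.1 (subset_chainClosure hq.2)

/-- Lengths only grow along a chain. The truncation makes the contribution of the mass still alive
vanish in the limit. -/
theorem lintegral_min_le_pairStep {c : X → X → ℝ≥0∞} {Γ : Set (X × X)}
    (hc : IsExtDistance c) (hcm : Measurable fun p : X × X => c p.1 p.2) (hΓm : MeasurableSet Γ)
    (hΓ : IsCyclicallyMonotoneSet c Γ) {Q : Measure (X × X)} [IsFiniteMeasure Q]
    (hQ : ∀ᵐ p ∂Q, p ∈ chainClosure Γ) (hQΓ : ∀ᵐ p ∂((Q.map Prod.snd) ⊗ₘ K), p ∈ Γ)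
    (M : ℝ≥0∞) :
    ∫⁻ p, min (c p.1 p.2) M ∂Q ≤ ∫⁻ p, min (c p.1 p.2) M ∂(pairStep K Q) := by
  have hcM : Measurable fun p : X × X => min (c p.1 p.2) M := hcm.min measurable_const
  have h1 : ∫⁻ p, min (c p.1 p.2) M ∂Q
      = ∫⁻ q, min (c q.1.1 q.1.2) M ∂(Q ⊗ₘ (K.comap Prod.snd measurable_snd)) := by
    conv_lhs => rw [← Measure.fst_compProd Q (K.comap Prod.snd measurable_snd)]
    exact lintegral_map hcM measurable_fst
  rw [h1, pairStep, lintegral_map hcM measurable_pairStep_map]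
  refine lintegral_mono_ae ?_
  filter_upwards [ae_compProd_comap_snd hΓm hQ hQΓ] with q hq
  have := (hΓ.chainClosure hc).dist_eq_add hc hq.1 (subset_chainClosure hq.2)
  simp only [this]
  exact min_le_min_right _ le_self_add

end Stopping

/-! ### Chain closure and cost of the stopped law. -/

section Cost

open ProbabilityTheory

variable {X : Type*} [MetricSpace X] [PolishSpace X] [MeasurableSpace X] [BorelSpace X]
  {c : X → X → ℝ≥0∞} {Γ : Set (X × X)} {K : Kernel X X} [IsMarkovKernel K] {f : X → ℝ≥0∞}
  {m : Measure X}

/-- `chainClosure Γ` is built from projections and need not be Borel, so the passage to the image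
law rests on `ae_map_of_ae_of_continuous`. -/
theorem ae_pairStep {Q : Measure (X × X)} [IsFiniteMeasure Q]
    (hΓm : MeasurableSet Γ) (hQ : ∀ᵐ p ∂Q, p ∈ chainClosure Γ)
    (hQΓ : ∀ᵐ p ∂((Q.map Prod.snd) ⊗ₘ K), p ∈ Γ) :
    ∀ᵐ p ∂(pairStep K Q), p ∈ chainClosure Γ := by
  refine ae_map_of_ae_of_continuous _ (by fun_prop) ?_
  filter_upwards [ae_compProd_comap_snd hΓm hQ hQΓ] with q hq
  exact chainClosure_trans_mem hq.1 hq.2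

theorem ae_map_diag_chainClosure (m : Measure X) [IsFiniteMeasure m] :
    ∀ᵐ p ∂(m.map fun x => (x, x)), p ∈ chainClosure Γ :=
  ae_map_of_ae_of_continuous m (by fun_prop) (ae_of_all _ fun x => diag_mem_chainClosure x)

variable [IsFiniteMeasure m]

theorem ae_aliveLaw {μ : Measure X} [IsFiniteMeasure μ] (hf1 : ∀ x, f x ≤ 1)
    (hΓm : MeasurableSet Γ) (hocc : occupation K f m ≤ μ) (hμΓ : ∀ᵐ p ∂(μ ⊗ₘ K), p ∈ Γ) (n : ℕ) :
    ∀ᵐ p ∂(aliveLaw K f m n), p ∈ chainClosure Γ := by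
  induction n with
  | zero => exact ae_map_diag_chainClosure m
  | succ n ih =>
    have := isFiniteMeasure_aliveLaw (K := K) (m := m) hf1 n
    exact (withDensity_absolutelyContinuous _ _).ae_le
      (ae_pairStep hΓm ih (ae_map_snd_aliveLaw_compProd hocc hμΓ n))

theorem ae_sum_stoppedLaw {μ : Measure X} [IsFiniteMeasure μ] (hf1 : ∀ x, f x ≤ 1)
    (hΓm : MeasurableSet Γ) (hocc : occupation K f m ≤ μ) (hμΓ : ∀ᵐ p ∂(μ ⊗ₘ K), p ∈ Γ) :
    ∀ᵐ p ∂(Measure.sum (stoppedLaw K f m)), p ∈ chainClosure Γ := by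
  refine Measure.ae_sum_iff.2 fun n => ?_
  have := isFiniteMeasure_aliveLaw (K := K) (m := m) hf1 n
  exact (withDensity_absolutelyContinuous _ _).ae_le
    (ae_pairStep hΓm (ae_aliveLaw hf1 hΓm hocc hμΓ n) (ae_map_snd_aliveLaw_compProd hocc hμΓ n))

/-- The cost of the law of the killed chain is the cost of all the steps made before killing. -/
theorem lintegral_sum_stoppedLaw (hc : IsExtDistance c)
    (hcm : Measurable fun p : X × X => c p.1 p.2) (hΓm : MeasurableSet Γ)
    (hΓ : IsCyclicallyMonotoneSet c Γ) {μ : Measure X} [IsFiniteMeasure μ] (hf : Measurable f)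
    (hf1 : ∀ x, f x ≤ 1) (hμ : m + (μ.bind K).withDensity f ≤ μ)
    (hμΓ : ∀ᵐ p ∂(μ ⊗ₘ K), p ∈ Γ) :
    ∫⁻ p, c p.1 p.2 ∂(Measure.sum (stoppedLaw K f m))
      = ∫⁻ p, c p.1 p.2 ∂((occupation K f m) ⊗ₘ K) := by
  have hocc := occupation_le hf hf1 hμ
  have hQf := isFiniteMeasure_aliveLaw (K := K) (m := m) hf1
  have hQ := ae_aliveLaw hf1 hΓm hocc hμΓ
  have hQΓ := ae_map_snd_aliveLaw_compProd hocc hμΓ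
  set A : ℕ → ℝ≥0∞ := fun n => ∫⁻ p, c p.1 p.2 ∂(aliveLaw K f m n) with hA
  set S : ℕ → ℝ≥0∞ := fun n => ∫⁻ p, c p.1 p.2 ∂(stoppedLaw K f m n) with hS
  set C : ℕ → ℝ≥0∞ := fun n => ∫⁻ p, c p.1 p.2 ∂(((aliveLaw K f m n).map Prod.snd) ⊗ₘ K) with hC
  have hstep : ∀ n, S n + A (n + 1) = A n + C n := fun n => by
    simp only [hA, hS, hC]
    rw [← lintegral_add_measure, stoppedLaw_add_aliveLaw hf hf1,
      lintegral_pairStep_eq_add hc hcm hΓm hΓ (hQ n) (hQΓ n)]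
  have hA0 : A 0 = 0 := by
    simp only [hA, aliveLaw]
    rw [lintegral_map hcm (by fun_prop)]
    simp [(hc.eq_zero_iff _ _).2 rfl]
  have hsum : ∀ N, ∑ n ∈ Finset.range N, S n + A N = ∑ n ∈ Finset.range N, C n := by
    intro N
    induction N with
    | zero => simp [hA0]
    | succ N ih => rw [Finset.sum_range_succ, Finset.sum_range_succ, add_assoc, hstep, ← add_assoc,
        ih]
  -- the length accumulated by the chains alive at time `k` is kept until they are killed
  have htail : ∀ k, A k ≤ ∑' n, S (n + k) := by
    intro k
    -- With the length cut off at `M`, what is alive at a late time contributes at most `M` times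
    -- its mass, which tends to zero.
    have hM : ∀ M : ℕ, ∫⁻ p, min (c p.1 p.2) M ∂(aliveLaw K f m k) ≤ ∑' n, S (n + k) := by
      intro M
      have h1 : ∀ N, ∫⁻ p, min (c p.1 p.2) M ∂(aliveLaw K f m k)
          ≤ ∑ n ∈ Finset.range N, S (n + k) + M * aliveLaw K f m (N + k) univ := by
        intro N
        have h2 : ∀ N, ∫⁻ p, min (c p.1 p.2) M ∂(aliveLaw K f m k)
            ≤ ∑ n ∈ Finset.range N, S (n + k)
              + ∫⁻ p, min (c p.1 p.2) M ∂(aliveLaw K f m (N + k)) := by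
          intro N
          induction N with
          | zero => simp
          | succ N ih =>
            refine ih.trans ?_
            rw [Finset.sum_range_succ, add_assoc]
            gcongr
            refine (lintegral_min_le_pairStep hc hcm hΓm hΓ (hQ _) (hQΓ _) M).trans ?_
            rw [← stoppedLaw_add_aliveLaw hf hf1, lintegral_add_measure, Nat.add_right_comm]
            gcongr
            exact lintegral_mono fun p => min_le_left _ _
        refine (h2 N).trans ?_
        gcongr
        rw [← lintegral_const]
        exact lintegral_mono fun p => min_le_right _ _
      have h3 : Filter.Tendsto (fun N => ∑ n ∈ Finset.range N, S (n + k)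
          + M * aliveLaw K f m (N + k) univ) Filter.atTop (nhds (∑' n, S (n + k) + M * 0)) := by
        refine (ENNReal.tendsto_nat_tsum _).add (ENNReal.Tendsto.const_mul ?_ (Or.inr (by simp)))
        exact (Filter.tendsto_add_atTop_iff_nat k).2 (tendsto_aliveLaw_univ hf hf1 hμ)
      rw [mul_zero, add_zero] at h3
      exact ge_of_tendsto' h3 h1
    have hsup : ∀ a : ℝ≥0∞, ⨆ M : ℕ, min a M = a := fun a => by
      rw [← inf_iSup_eq, ENNReal.iSup_natCast, inf_top_eq]
    calc A k = ∫⁻ p, ⨆ M : ℕ, min (c p.1 p.2) M ∂(aliveLaw K f m k) := by simp only [hsup, hA]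
      _ = ⨆ M : ℕ, ∫⁻ p, min (c p.1 p.2) M ∂(aliveLaw K f m k) := by
        refine lintegral_iSup (fun M => hcm.min measurable_const) fun M M' h p => ?_
        exact min_le_min_left _ (by exact_mod_cast h)
      _ ≤ _ := iSup_le hM
  have hSC : ∑' n, S n = ∑' n, C n := by
    apply le_antisymm
    · rw [ENNReal.tsum_eq_iSup_nat, ENNReal.tsum_eq_iSup_nat]
      exact iSup_mono fun N => le_self_add.trans (hsum N).le
    · rw [ENNReal.tsum_eq_iSup_nat (f := C)]
      refine iSup_le fun N => ?_
      rw [← hsum, ← Summable.sum_add_tsum_nat_add' (k := N) (f := S) ENNReal.summable]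
      gcongr
      exact htail N
  have hoC : ∫⁻ p, c p.1 p.2 ∂((occupation K f m) ⊗ₘ K) = ∑' n, C n := by
    rw [occupation, Measure.compProd_sum_left, lintegral_sum_measure]
  rw [lintegral_sum_measure, hoC]
  exact hSC

end Cost

/-! ### Assembly of the new plan. -/

/-- Removing a measurable null hull of `Γᶜ` leaves a measurable subset of `Γ` of full measure. -/
theorem IsCyclicallyMonotonePlan.of_ae {X : Type*} [MeasurableSpace X] {c : X → X → ℝ≥0∞}
    {Γ : Set (X × X)} (hΓ : IsCyclicallyMonotoneSet c Γ) {π : Measure (X × X)}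
    (h : ∀ᵐ p ∂π, p ∈ Γ) : IsCyclicallyMonotonePlan c π := by
  refine ⟨(toMeasurable π Γᶜ)ᶜ, (measurableSet_toMeasurable _ _).compl, hΓ.mono ?_, ?_⟩
  · exact compl_subset_comm.1 (subset_toMeasurable π Γᶜ)
  · rw [compl_compl, measure_toMeasurable]
    exact h

theorem exists_density_of_le {X : Type*} [MeasurableSpace X] {l ν : Measure X}
    [IsFiniteMeasure ν] (h : l ≤ ν) :
    ∃ f : X → ℝ≥0∞, Measurable f ∧ (∀ x, f x ≤ 1) ∧ ν.withDensity f = l := by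
  have : IsFiniteMeasure l := isFiniteMeasure_of_le ν h
  -- The cut-off makes the bound by `1` hold everywhere, so that `f` is a survival probability at
  -- every point.
  refine ⟨fun x => min (l.rnDeriv ν x) 1, (Measure.measurable_rnDeriv _ _).min measurable_const,
    fun x => min_le_right _ _, ?_⟩
  rw [← Measure.withDensity_rnDeriv_eq l ν h.absolutelyContinuous]
  refine withDensity_congr_ae ?_
  rw [Measure.withDensity_rnDeriv_eq l ν h.absolutelyContinuous]
  filter_upwards [Measure.rnDeriv_le_one_of_le h] with x hx
  exact min_eq_left hx

open ProbabilityTheory in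
theorem propositionP {X : Type*} [MetricSpace X] [PolishSpace X] [MeasurableSpace X] [BorelSpace X]
    (dL : X → X → ℝ≥0∞) (hdist : IsExtDistance dL)
    (hBorel : Measurable (fun p : X × X => dL p.1 p.2))
    (hgeod : IsGeodesicDistance dL) (hnb : IsNonBranching dL)
    (hcont : GeodesicsContinuous dL) (hlc : GeodesicsLocallyCompact dL)
    (μ ν : Measure X) [IsProbabilityMeasure μ] [IsProbabilityMeasure ν]
    (π : Measure (X × X)) (hπ : IsTransferencePlan μ ν π)
    (hmono : IsCyclicallyMonotonePlan dL π) (hcost : transportCost dL π ≠ ∞) :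
    ∃ π' : Measure (X × X),
      IsTransferencePlan μ ν π' ∧ IsCyclicallyMonotonePlan dL π' ∧
      transportCost dL π' = transportCost dL π ∧
      (μ ⊓ ν).map (fun x => (x, x)) ≤ π' := by
  obtain ⟨hπp, hπ1, hπ2⟩ := hπ
  obtain ⟨Γ₀, hΓ₀m, hΓ₀, hπΓ₀⟩ := hmono
  have hX : Nonempty X := nonempty_of_isProbabilityMeasure μ
  set K : Kernel X X := π.condKernel with hK
  have hdis : μ ⊗ₘ K = π := by rw [← hπ1]; exact π.disintegrate π.condKernel
  have hbind : μ.bind K = ν := by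
    rw [← hπ2, ← Measure.snd_compProd, hdis]; rfl
  have hfin : ∫⁻ p, dL p.1 p.2 ∂(μ ⊗ₘ K) ≠ ∞ := by rw [hdis]; exact hcost
  -- Finite cost allows discarding the pairs at infinite distance, which no geodesic joins.
  set Γ : Set (X × X) := Γ₀ ∩ {p | dL p.1 p.2 ≠ ∞} with hΓdef
  have hΓm : MeasurableSet Γ := hΓ₀m.inter (hBorel (measurableSet_singleton ∞).compl)
  have hΓ : IsCyclicallyMonotoneSet dL Γ := hΓ₀.mono inter_subset_left
  have hμΓ : ∀ᵐ p ∂(μ ⊗ₘ K), p ∈ Γ := by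
    filter_upwards [ae_lt_top hBorel hfin, hdis ▸ measure_eq_zero_iff_ae_notMem.1 hπΓ₀]
      with p h1 h2
    exact ⟨not_not.1 h2, h1.ne⟩
  set l := μ ⊓ ν with hl
  have hlμ : l ≤ μ := inf_le_left
  have hlν : l ≤ ν := inf_le_right
  have hlfin : IsFiniteMeasure l := isFiniteMeasure_of_le μ hlμ
  obtain ⟨f, hf, hf1, hfl⟩ := exists_density_of_le hlν
  set m := μ - l with hm
  have hmfin : IsFiniteMeasure m := isFiniteMeasure_of_le μ Measure.sub_le
  have hml : m + l = μ := Measure.sub_add_cancel_of_le hlμ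
  have hμ : m + (μ.bind K).withDensity f = μ := by rw [hbind, hfl, hml]
  set s := occupation K f m with hs
  have hocc : s ≤ μ := occupation_le hf hf1 hμ.le
  have hsfin : IsFiniteMeasure s := isFiniteMeasure_of_le μ hocc
  have hRfin : IsFiniteMeasure (μ - s) := isFiniteMeasure_of_le μ Measure.sub_le
  have hR0 : ∫⁻ p, dL p.1 p.2 ∂((μ - s) ⊗ₘ K) = 0 :=
    lintegral_compProd_eq_zero_of_stationary hdist hBorel hgeod hlc hΓ (fun p hp => hp.2) K (μ - s)
      (bind_sub_occupation hf hf1 hμ)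
      ((Measure.sub_le.absolutelyContinuous.compProd_left K).ae_le hμΓ)
  have hdiag : Measurable fun x : X => (x, x) := by fun_prop
  have hfst : (Measure.sum (stoppedLaw K f m) + l.map fun x => (x, x)).map Prod.fst = μ := by
    rw [Measure.map_add _ _ measurable_fst, map_fst_sum_stoppedLaw hf hf1 hμ.le,
      Measure.map_map measurable_fst hdiag]
    exact (congrArg (m + ·) Measure.map_id).trans hml
  have hsnd : (Measure.sum (stoppedLaw K f m) + l.map fun x => (x, x)).map Prod.snd = ν := by
    rw [Measure.map_add _ _ measurable_snd, map_snd_sum_stoppedLaw hf hf1 hμ,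
      Measure.map_map measurable_snd hdiag, hbind]
    refine (congrArg (ν.withDensity (fun x => 1 - f x) + ·) (Measure.map_id.trans hfl.symm)).trans ?_
    rw [← withDensity_add_left (by fun_prop)]
    conv_rhs => rw [← withDensity_one (μ := ν)]
    congr 1
    ext x
    simp [tsub_add_cancel_of_le (hf1 x)]
  refine ⟨Measure.sum (stoppedLaw K f m) + l.map fun x => (x, x), ⟨⟨?_⟩, hfst, hsnd⟩, ?_, ?_, ?_⟩
  · rw [← measure_univ (μ := μ), ← hfst, Measure.map_apply measurable_fst MeasurableSet.univ,
      preimage_univ]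
  · exact .of_ae (hΓ.chainClosure hdist) (ae_add_measure_iff.2
      ⟨ae_sum_stoppedLaw hf1 hΓm hocc hμΓ, ae_map_diag_chainClosure l⟩)
  · have h0 : ∫⁻ p, dL p.1 p.2 ∂(l.map fun x => (x, x)) = 0 := by
      rw [lintegral_map hBorel hdiag]
      simp [(hdist.eq_zero_iff _ _).2 rfl]
    rw [transportCost, lintegral_add_measure, h0, add_zero,
      lintegral_sum_stoppedLaw hdist hBorel hΓm hΓ hf hf1 hμ.le hμΓ, transportCost, ← hdis]
    -- The original cost splits into that of `μ - s`, which is zero, and that of `s`, which the new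
    -- plan pays.
    conv_rhs => rw [← Measure.sub_add_cancel_of_le hocc]
    rw [Measure.compProd_add_left, lintegral_add_measure, hR0, zero_add]
  · exact Measure.le_add_left le_rfl
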